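/- **Theorem (Strong law of large numbers for incremental sums).** Let $(\Omega,\mathcal F,\mathbb P)$ be a probability space and let $\{X_k(m) : k\in\mathbb N,\ m>0\}$ be a family of integrable real random variables on it that is independent in $k$, i.e. for every choice of $t_1,t_2,\ldots>0$ the random variables $X_1(t_1),X_2(t_2),\ldots$ are mutually independent. Assume: * (C) (centering) $\mathbb E[X_k(m)]=0$ for all $k\in\mathbb N$ and $m>0$; * (S1) (polynomial decay) there is a $\delta>0$ such that for every $\varepsilon>0$ there is a constant $C=C(\varepsilon)$ with $$\sup_{k}\mathbb P\big(|X_k(m)|>\varepsilon\big)\le \frac{C}{m^{\delta}}\qquad\text{for all } m>0;$$ * (S2) (stochastic domination and moment control) there are a random variable $X_*$ on $\Omega$ and a $\gamma>0$ such that $\mathbb E\big[|X_*|^{2+\gamma}\big]<\infty$ and $$\sup_{k\in\mathbb N,\,m>0}\mathbb P\big(|X_k(m)|>x\big)\le \mathbb P\big(|X_*|>x\big)\qquad\text{for all } x\in\mathbb R.$$ Let $(m_k)_{k\in\mathbb N}$ be any sequence of masses $m_k\ge 0$ with $\sum_{k} m_k=\infty$. Put $M_n=\sum_{k=1}^n m_k$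 and $$S_n=\sum_{k=1}^n \frac{m_k}{M_n}\,X_k(m_k)$$ (terms with $m_k=0$ are zero; $M_n>0$ for all large $n$). Then $$\mathbb P\Big(\lim_{n\to\infty}S_n=0\Big)=1.$$ -/

import Mathlib

open MeasureTheory ProbabilityTheory Filter Topology

/-- The accumulated mass of the first `n` increments (increments are numbered from `0`). -/
noncomputable def totalMass (m : ℕ → ℝ) (n : ℕ) : ℝ :=
  ∑ k ∈ Finset.range n, m k

/-- The incremental sum of the first `n` increments: the average of the variables `X k (m k)`,
weighted by the masses `m k`. -/
noncomputable def incrementalSum {Ω : Type*} (X : ℕ → ℝ → Ω → ℝ) (m : ℕ → ℝ) (n : ℕ)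
    (ω : Ω) : ℝ :=
  ∑ k ∈ Finset.range n, m k / totalMass m n * X k (m k) ω

/-- `X k t`, for `k : ℕ` and `t > 0`, is a family of integrable random variables which is
independent in `k`: the variables `X k (t k)` are mutually independent for each choice of positive
parameters `t k`. (This holds in particular when the processes `(X k t)_{t > 0}` are
independent for different `k`.) Nothing is required at parameters `t ≤ 0`. -/
structure IsIndependentFamily {Ω : Type*} [MeasurableSpace Ω] (P : Measure Ω)
    (X : ℕ → ℝ → Ω → ℝ) : Prop where
  measurable : ∀ k t, 0 < t → Measurable (X k t)
  integrable : ∀ k t, 0 < t → Integrable (X k t) P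
  indep : ∀ t : ℕ → ℝ, (∀ k, 0 < t k) → iIndepFun (fun k => X k (t k)) P

/-- Centering: all the variables have mean zero. -/
def IsCentred {Ω : Type*} [MeasurableSpace Ω] (P : Measure Ω) (X : ℕ → ℝ → Ω → ℝ) : Prop :=
  ∀ k t, 0 < t → ∫ ω, X k t ω ∂P = 0

/-- Polynomial decay: concentration around zero at a polynomial rate in the parameter, uniformly
in the index. The exponent `δ` does not depend on `ε`, the constant `C` may. -/
def HasPolynomialDecay {Ω : Type*} [MeasurableSpace Ω] (P : Measure Ω)
    (X : ℕ → ℝ → Ω → ℝ) : Prop :=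
  ∃ δ : ℝ, 0 < δ ∧ ∀ ε : ℝ, 0 < ε → ∃ C : ℝ, ∀ t : ℝ, 0 < t → ∀ k : ℕ,
    P.real {ω | ε < |X k t ω|} ≤ C / t ^ δ

/-- Stochastic domination of all the variables, in absolute value, by a single random variable
with a finite absolute moment of some order larger than `2`. -/
def IsStochasticallyDominated {Ω : Type*} [MeasurableSpace Ω] (P : Measure Ω)
    (X : ℕ → ℝ → Ω → ℝ) : Prop :=
  ∃ (Xstar : Ω → ℝ) (γ : ℝ), Measurable Xstar ∧ 0 < γ ∧
    Integrable (fun ω => |Xstar ω| ^ (2 + γ)) P ∧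
    ∀ (x : ℝ) (k : ℕ) (t : ℝ), 0 < t → P {ω | x < |X k t ω|} ≤ P {ω | x < |Xstar ω|}

/-!
Fix `ε > 0` and split each `X k (m k)` into its truncation at level `ε` and the remaining large
part. Since the variables are centred, the truncations and the means of the large parts contribute
at most `2 ε` to every weighted average, so it suffices that the averages of the centred large parts
tend to `0` almost surely.

By Kronecker's lemma this follows from the almost sure convergence of the series
`∑ (m k / M (k + 1)) * (L k - 𝔼[L k])`, where `L k` is the large part of `X k (m k)` and `M` denotes
the total mass. For `1 < q ≤ 2`, a series of independent variables whose `q`-th absolute moments are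
summable converges almost surely once centred. If the `p`-th moments of the `X k (m k)` are bounded
for some `p > q`, then Hölder's inequality and the polynomial decay give a moment bound
`𝔼|L k|^q ≤ D * (m k)^(-s)` with `0 < s ≤ q - 1`. The `q`-th moments of the series are therefore at
most `D * m k * M (k + 1)^(-(1 + s)) ≤ (D / s) * (M k^(-s) - M (k + 1)^(-s))`, which telescopes.
-/

open scoped ENNReal NNReal

section Deterministic

variable {E : Type*} [NormedAddCommGroup E] [NormedSpace ℝ E]

theorem tendsto_inv_smul_sum_sub_smul {b : ℕ → ℝ} {u : ℕ → E} {a : E} (hb : Monotone b)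
    (hbtop : Tendsto b atTop atTop) (hu : Tendsto u atTop (𝓝 a)) :
    Tendsto (fun n => (b n)⁻¹ • ∑ k ∈ Finset.range n, (b (k + 1) - b k) • u k) atTop (𝓝 a) := by
  have hweights : Tendsto (fun n => ∑ k ∈ Finset.range n, (b (k + 1) - b k)) atTop atTop := by
    simp only [Finset.sum_range_sub]
    exact tendsto_atTop_add_const_right _ (-b 0) hbtop
  have herror : (fun n => ∑ k ∈ Finset.range n, (b (k + 1) - b k) • (u k - a)) =o[atTop] b := by
    have hterm : (fun k => (b (k + 1) - b k) • (u k - a)) =o[atTop] fun k => b (k + 1) - b k := by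
      simpa using (Asymptotics.isBigO_refl (fun k => b (k + 1) - b k) atTop).smul_isLittleO
        ((Asymptotics.isLittleO_one_iff ℝ).mpr (tendsto_sub_nhds_zero_iff.mpr hu))
    refine (hterm.sum_range (fun k => sub_nonneg.mpr (hb k.le_succ)) hweights).trans_isBigO ?_
    simp only [Finset.sum_range_sub]
    exact (Asymptotics.isBigO_refl b atTop).sub
      (Asymptotics.isLittleO_const_left.mpr (.inr (tendsto_norm_atTop_atTop.comp hbtop))).isBigO
  have hlim : Tendsto (fun n => (b n)⁻¹ • ∑ k ∈ Finset.range n, (b (k + 1) - b k) • (u k - a) +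
      (a - (b n)⁻¹ • b 0 • a)) atTop (𝓝 (0 + (a - (0 : ℝ) • b 0 • a))) :=
    herror.tendsto_inv_smul_nhds_zero.add
      (tendsto_const_nhds.sub (hbtop.inv_tendsto_atTop.smul_const _))
  rw [zero_smul, sub_zero, zero_add] at hlim
  refine hlim.congr' ?_
  filter_upwards [hbtop.eventually_ne_atTop 0] with n hn
  have hcentre : ∑ k ∈ Finset.range n, (b (k + 1) - b k) • (u k - a) =
      ∑ k ∈ Finset.range n, (b (k + 1) - b k) • u k - (b n • a - b 0 • a) := by
    simp_rw [smul_sub]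
    rw [Finset.sum_sub_distrib, ← Finset.sum_smul, Finset.sum_range_sub, sub_smul]
  rw [hcentre, smul_sub, smul_sub, inv_smul_smul₀ hn, sub_add_cancel]

/-- **Kronecker's lemma**. -/
theorem tendsto_inv_smul_sum_smul_of_tendsto_sum {b : ℕ → ℝ} {x : ℕ → E} {s : E} (hb : Monotone b)
    (hbtop : Tendsto b atTop atTop)
    (hs : Tendsto (fun n => ∑ k ∈ Finset.range n, x k) atTop (𝓝 s)) :
    Tendsto (fun n => (b n)⁻¹ • ∑ k ∈ Finset.range (n + 1), b k • x k) atTop (𝓝 0) := by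
  have hs' := hs.comp (tendsto_add_atTop_nat 1)
  have hlim := hs'.sub (tendsto_inv_smul_sum_sub_smul hb hbtop hs')
  rw [sub_self] at hlim
  refine hlim.congr' ?_
  filter_upwards [hbtop.eventually_ne_atTop 0] with n hn
  rw [Finset.sum_range_by_parts b x, Nat.add_sub_cancel, smul_sub, inv_smul_smul₀ hn]
  rfl

theorem sub_mul_rpow_le {s a b : ℝ} (hs : 0 < s) (ha : 0 < a) (hb : 0 < b) :
    (b - a) * b ^ (-(1 + s)) ≤ s⁻¹ * (a ^ (-s) - b ^ (-s)) := by
  have hbernoulli : 1 + (1 + s) * (b / a - 1) ≤ (b / a) ^ (1 + s) := by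
    simpa using one_add_mul_self_le_rpow_one_add (s := b / a - 1)
      (by linarith [div_pos hb ha]) (by linarith : 1 ≤ 1 + s)
  rw [Real.div_rpow hb.le ha.le] at hbernoulli
  have hsplit : ∀ x : ℝ, 0 < x → x ^ (-s) = x * x ^ (-(1 + s)) := fun x hx => by
    rw [neg_add, Real.rpow_add hx, Real.rpow_neg_one, mul_inv_cancel_left₀ hx.ne']
  rw [le_inv_mul_iff₀ hs, hsplit a ha, hsplit b hb, Real.rpow_neg ha.le, Real.rpow_neg hb.le]
  have hA := Real.rpow_pos_of_pos ha (1 + s)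
  have hB := Real.rpow_pos_of_pos hb (1 + s)
  rw [le_div_iff₀ hA] at hbernoulli
  field_simp at hbernoulli ⊢
  linarith

theorem summable_sub_mul_rpow {s : ℝ} {b : ℕ → ℝ} (hs : 0 < s) (hb : Monotone b) {N : ℕ}
    (hN : 0 < b N) : Summable fun k => (b (k + 1) - b k) * b (k + 1) ^ (-(1 + s)) := by
  rw [← summable_nat_add_iff N]
  have hpos : ∀ k, 0 < b (k + N) := fun k => hN.trans_le (hb (Nat.le_add_left N k))
  have hpos' : ∀ k, 0 < b (k + N + 1) := fun k => (hpos k).trans_le (hb (Nat.le_succ _))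
  refine summable_of_sum_range_le (c := s⁻¹ * b N ^ (-s))
    (fun k => mul_nonneg (sub_nonneg.mpr (hb (Nat.le_succ _))) (Real.rpow_nonneg (hpos' k).le _))
    fun n => ?_
  calc ∑ k ∈ Finset.range n, (b (k + N + 1) - b (k + N)) * b (k + N + 1) ^ (-(1 + s))
      ≤ ∑ k ∈ Finset.range n, s⁻¹ * (b (k + N) ^ (-s) - b (k + 1 + N) ^ (-s)) :=
        Finset.sum_le_sum fun k _ => by
          rw [Nat.add_right_comm k 1 N]
          exact sub_mul_rpow_le hs (hpos k) (hpos' k)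
    _ = s⁻¹ * (b N ^ (-s) - b (n + N) ^ (-s)) := by
        rw [← Finset.mul_sum, Finset.sum_range_sub' fun k => b (k + N) ^ (-s), Nat.zero_add]
    _ ≤ s⁻¹ * b N ^ (-s) := by
        gcongr
        linarith [Real.rpow_nonneg (hpos n).le (-s)]

theorem div_rpow_mul_rpow_neg_le {a b q s : ℝ} (ha : 0 < a) (hab : a ≤ b) (hsq : s ≤ q - 1) :
    (a / b) ^ q * a ^ (-s) ≤ a * b ^ (-(1 + s)) := by
  have hb : 0 < b := ha.trans_le hab
  calc (a / b) ^ q * a ^ (-s) = a * a ^ (q - 1 - s) * b ^ (-q) := by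
        have ha_split : a ^ q * a ^ (-s) = a * a ^ (q - 1 - s) := by
          rw [← Real.rpow_add ha, ← Real.rpow_one_add' ha.le (by linarith)]
          ring_nf
        rw [Real.div_rpow ha.le hb.le, ← ha_split, Real.rpow_neg hb.le]
        ring
    _ ≤ a * b ^ (q - 1 - s) * b ^ (-q) := by
        gcongr
    _ = a * b ^ (-(1 + s)) := by
        rw [mul_assoc, ← Real.rpow_add hb]
        ring_nf

theorem rpow_le_max_one_mul_rpow_neg {x C t δ θ s : ℝ} (hx0 : 0 ≤ x) (hx1 : x ≤ 1) (ht : 0 < t)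
    (hx : x ≤ C / t ^ δ) (hθ0 : 0 ≤ θ) (hθ1 : θ ≤ 1) (hs : 0 ≤ s) (hsθ : s ≤ θ * δ) :
    x ^ θ ≤ max 1 C * t ^ (-s) := by
  rcases le_or_gt t 1 with ht1 | ht1
  · calc x ^ θ ≤ 1 * 1 := by simpa using Real.rpow_le_one hx0 hx1 hθ0
      _ ≤ max 1 C * t ^ (-s) := by
        gcongr
        · exact le_max_left _ _
        · exact Real.one_le_rpow_of_pos_of_le_one_of_nonpos ht ht1 (neg_nonpos.mpr hs)
  · have hmax : 1 ≤ max 1 C := le_max_left _ _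
    calc x ^ θ ≤ (max 1 C * t ^ (-δ)) ^ θ := by
          refine Real.rpow_le_rpow hx0 (hx.trans ?_) hθ0
          rw [Real.rpow_neg ht.le, ← div_eq_mul_inv]
          gcongr
          exact le_max_right _ _
      _ = max 1 C ^ θ * t ^ (-(θ * δ)) := by
          rw [Real.mul_rpow (by positivity) (by positivity), ← Real.rpow_mul ht.le]
          ring_nf
      _ ≤ max 1 C * t ^ (-s) := by
          gcongr
          · exact Real.rpow_le_self_of_one_le hmax hθ1
          · exact ht1.le

end Deterministic

section IndependentSeries

variable {Ω : Type*} [MeasurableSpace Ω] {P : Measure Ω} {W : ℕ → Ω → ℝ}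

theorem martingale_sum_sub_integral (hind : iIndepFun W P) (hmeas : ∀ k, StronglyMeasurable (W k))
    (hint : ∀ k, Integrable (W k) P) :
    Martingale (fun n => ∑ k ∈ Finset.range (n + 1), fun ω => W k ω - P[W k])
      (Filtration.natural W hmeas) P := by
  have : IsProbabilityMeasure P := hind.isProbabilityMeasure
  set 𝒢 := Filtration.natural W hmeas
  have hint' : ∀ k, Integrable (fun ω => W k ω - P[W k]) P := fun k =>
    (hint k).sub (integrable_const _)
  have hadapted : StronglyAdapted 𝒢
      fun n => ∑ k ∈ Finset.range (n + 1), fun ω => W k ω - P[W k] := fun n =>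
    Finset.stronglyMeasurable_sum _ fun k hk =>
      ((Filtration.stronglyAdapted_natural hmeas k).mono
        (𝒢.mono (Finset.mem_range_succ_iff.mp hk))).sub stronglyMeasurable_const
  refine martingale_of_condExp_sub_eq_zero_nat hadapted
    (fun n => integrable_finsetSum' _ fun k _ => hint' k) fun n => ?_
  rw [Finset.sum_range_succ _ (n + 1), add_sub_cancel_left]
  have hincrement : P[fun ω => W (n + 1) ω - P[W (n + 1)] | 𝒢 n] =ᵐ[P]
      P[W (n + 1) | 𝒢 n] - P[fun _ => P[W (n + 1)] | 𝒢 n] :=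
    condExp_sub (hint (n + 1)) (integrable_const _) _
  filter_upwards [hincrement, hind.condExp_natural_ae_eq_of_lt hmeas n.lt_succ_self]
    with ω hsub hmean
  rw [hsub, Pi.sub_apply, hmean, condExp_const (𝒢.le n), sub_self, Pi.zero_apply]

theorem evariance_sum_of_iIndepFun {ι : Type*} {W : ι → Ω → ℝ} (hind : iIndepFun W P)
    (hL2 : ∀ i, MemLp (W i) 2 P) (s : Finset ι) :
    eVar[∑ i ∈ s, W i; P] = ∑ i ∈ s, eVar[W i; P] := by
  have : IsProbabilityMeasure P := hind.isProbabilityMeasure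
  rw [← ofReal_variance (memLp_finsetSum' s fun k _ => hL2 k),
    IndepFun.variance_sum (fun k _ => hL2 k) fun i _ j _ hij => hind.indepFun hij,
    ENNReal.ofReal_sum_of_nonneg fun k _ => variance_nonneg _ _]
  exact Finset.sum_congr rfl fun k _ => ofReal_variance (hL2 k)

theorem eLpNorm_two_sub_integral (f : Ω → ℝ) :
    eLpNorm (fun ω => f ω - P[f]) 2 P = eVar[f; P] ^ (1 / 2 : ℝ) := by
  simp [eLpNorm_eq_lintegral_rpow_enorm_toReal, evariance]

/-- **Kolmogorov's one-series theorem**. -/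
theorem ae_exists_tendsto_sum_of_tsum_evariance_ne_top (hind : iIndepFun W P)
    (hmeas : ∀ k, Measurable (W k)) (hvar : ∑' k, eVar[W k; P] ≠ ∞) :
    ∀ᵐ ω ∂P, ∃ s, Tendsto (fun n => ∑ k ∈ Finset.range n, (W k ω - P[W k])) atTop (𝓝 s) := by
  have : IsProbabilityMeasure P := hind.isProbabilityMeasure
  have hL2 : ∀ k, MemLp (W k) 2 P := fun k =>
    (evariance_lt_top_iff_memLp (hmeas k).aestronglyMeasurable).mp
      (ENNReal.ne_top_of_tsum_ne_top hvar k).lt_top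
  have hint : ∀ k, Integrable (W k) P := fun k => (hL2 k).integrable one_le_two
  have hmart := martingale_sum_sub_integral hind (fun k => (hmeas k).stronglyMeasurable) hint
  have hcentre : ∀ n, (∑ k ∈ Finset.range (n + 1), fun ω => W k ω - P[W k]) =
      fun ω => (∑ k ∈ Finset.range (n + 1), W k) ω - P[∑ k ∈ Finset.range (n + 1), W k] := by
    intro n
    ext ω
    simp only [Finset.sum_apply, Finset.sum_sub_distrib]
    rw [integral_finsetSum _ fun k _ => hint k]
  have hbdd : ∀ n, eLpNorm (∑ k ∈ Finset.range (n + 1), fun ω => W k ω - P[W k]) 1 P ≤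
      ((∑' k, eVar[W k; P]) ^ (1 / 2 : ℝ)).toNNReal := by
    intro n
    rw [ENNReal.coe_toNNReal (ENNReal.rpow_ne_top_of_nonneg (by norm_num) hvar)]
    calc eLpNorm (∑ k ∈ Finset.range (n + 1), fun ω => W k ω - P[W k]) 1 P
        ≤ eLpNorm (∑ k ∈ Finset.range (n + 1), fun ω => W k ω - P[W k]) 2 P :=
          eLpNorm_le_eLpNorm_of_exponent_le one_le_two
            (hmart.integrable n).aestronglyMeasurable
      _ = (∑ k ∈ Finset.range (n + 1), eVar[W k; P]) ^ (1 / 2 : ℝ) := by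
          rw [hcentre, eLpNorm_two_sub_integral, evariance_sum_of_iIndepFun hind hL2]
      _ ≤ (∑' k, eVar[W k; P]) ^ (1 / 2 : ℝ) := by
          gcongr
          exact ENNReal.sum_le_tsum _
  filter_upwards [hmart.submartingale.exists_ae_tendsto_of_bdd hbdd] with ω ⟨s, hs⟩
  exact ⟨s, (tendsto_add_atTop_iff_nat 1).mp (by simpa only [Finset.sum_apply] using hs)⟩

end IndependentSeries

section LargePart

/-- The part of `x` exceeding the threshold `ε` in absolute value: `x` itself if `ε < |x|`, and `0`
otherwise. Truncation at level `ε` is `x - largePart ε x`. -/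
noncomputable def largePart (ε : ℝ) : ℝ → ℝ :=
  {x | ε < |x|}.indicator id

theorem measurable_largePart (ε : ℝ) : Measurable (largePart ε) :=
  measurable_id.indicator (measurableSet_lt measurable_const measurable_id.abs)

theorem abs_sub_largePart_le {ε : ℝ} (hε : 0 ≤ ε) (x : ℝ) : |x - largePart ε x| ≤ ε := by
  by_cases hx : ε < |x|
  · simpa [largePart, hx] using hε
  · simpa [largePart, hx] using not_lt.mp hx

theorem enorm_sub_largePart_one_sq_le {q : ℝ} (hq : q ≤ 2) (x : ℝ) :
    ‖x - largePart 1 x‖ₑ ^ 2 ≤ ‖x‖ₑ ^ q := by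
  rw [← ENNReal.rpow_two]
  by_cases hx : 1 < |x|
  · simp [largePart, hx]
  · have hx1 : ‖x‖ₑ ≤ 1 := by simpa [Real.enorm_eq_ofReal_abs] using hx
    simpa [largePart, hx] using ENNReal.rpow_le_rpow_of_exponent_ge hx1 hq

theorem enorm_largePart_one_le {q : ℝ} (hq : 1 ≤ q) (x : ℝ) : ‖largePart 1 x‖ₑ ≤ ‖x‖ₑ ^ q := by
  by_cases hx : 1 < |x|
  · have hx1 : 1 ≤ ‖x‖ₑ := by simpa [Real.enorm_eq_ofReal_abs] using hx.le
    simpa [largePart, hx] using ENNReal.rpow_le_rpow_of_exponent_le hx1 hq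
  · simp [largePart, hx]

variable {Ω : Type*} [MeasurableSpace Ω] {μ : Measure Ω} {f : Ω → ℝ}

theorem eLpNorm_largePart_comp_le {p q : ℝ≥0} (hf : Measurable f) (hqp : q ≤ p) (ε : ℝ) :
    eLpNorm (largePart ε ∘ f) q μ ≤
      eLpNorm f p μ * μ {ω | ε < |f ω|} ^ (1 / (q : ℝ) - 1 / (p : ℝ)) := by
  have hset : MeasurableSet {ω | ε < |f ω|} := measurableSet_lt measurable_const hf.abs
  have hcomp : largePart ε ∘ f = {ω | ε < |f ω|}.indicator f :=
    funext fun ω => (Set.indicator_comp_right f (s := {x | ε < |x|}) (g := id)).symm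
  rw [hcomp, eLpNorm_indicator_eq_eLpNorm_restrict hset]
  calc eLpNorm f q (μ.restrict {ω | ε < |f ω|})
      ≤ eLpNorm f p (μ.restrict {ω | ε < |f ω|}) *
          μ.restrict {ω | ε < |f ω|} Set.univ ^ (1 / (q : ℝ) - 1 / (p : ℝ)) :=
        eLpNorm_le_eLpNorm_mul_rpow_measure_univ (by exact_mod_cast hqp)
          hf.aestronglyMeasurable
    _ ≤ eLpNorm f p μ * μ {ω | ε < |f ω|} ^ (1 / (q : ℝ) - 1 / (p : ℝ)) := by
        rw [Measure.restrict_apply_univ]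
        gcongr
        exact Measure.restrict_le_self

theorem evariance_sub_largePart_one_comp_le [IsProbabilityMeasure μ] {q : ℝ≥0} (hf : Measurable f)
    (hq0 : q ≠ 0) (hq2 : q ≤ 2) :
    eVar[f - largePart 1 ∘ f; μ] ≤ eLpNorm f q μ ^ (q : ℝ) := by
  rw [evariance_def' (hf.sub ((measurable_largePart 1).comp hf)).aestronglyMeasurable,
    eLpNorm_nnreal_pow_eq_lintegral hq0]
  exact tsub_le_self.trans
    (lintegral_mono fun ω => enorm_sub_largePart_one_sq_le (by exact_mod_cast hq2) _)

theorem eLpNorm_one_largePart_one_comp_le {q : ℝ≥0} (hq : 1 ≤ q) :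
    eLpNorm (largePart 1 ∘ f) 1 μ ≤ eLpNorm f q μ ^ (q : ℝ) := by
  rw [eLpNorm_one_eq_lintegral_enorm,
    eLpNorm_nnreal_pow_eq_lintegral (zero_lt_one.trans_le hq).ne']
  exact lintegral_mono fun ω => enorm_largePart_one_le (by exact_mod_cast hq) _

theorem integrable_sub_largePart_comp [IsFiniteMeasure μ] {ε : ℝ} (hf : Measurable f)
    (hε : 0 ≤ ε) : Integrable (f - largePart ε ∘ f) μ :=
  .of_bound (hf.sub ((measurable_largePart ε).comp hf)).aestronglyMeasurable ε
    (ae_of_all _ fun _ => abs_sub_largePart_le hε _)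

end LargePart

section MomentSeries

variable {Ω : Type*} [MeasurableSpace Ω] {P : Measure Ω} {W : ℕ → Ω → ℝ}

theorem ae_exists_tendsto_sum_of_tsum_eLpNorm_one_ne_top [IsProbabilityMeasure P]
    (hmeas : ∀ k, AEStronglyMeasurable (W k) P) (hsum : ∑' k, eLpNorm (W k) 1 P ≠ ∞) :
    ∀ᵐ ω ∂P, ∃ s, Tendsto (fun n => ∑ k ∈ Finset.range n, (W k ω - P[W k])) atTop (𝓝 s) := by
  have hmeans : Summable fun k => P[W k] := by
    refine Summable.of_norm_bounded (ENNReal.summable_toReal hsum) fun k => ?_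
    rw [← toReal_enorm]
    refine ENNReal.toReal_mono (ENNReal.ne_top_of_tsum_ne_top hsum k) ?_
    rw [eLpNorm_one_eq_lintegral_enorm]
    exact enorm_integral_le_lintegral_enorm _
  filter_upwards [summable_norm_of_tsum_eLpNorm_ne_top le_rfl hmeas hsum] with ω hω
  exact ⟨_, (hω.of_norm.sub hmeans).hasSum.tendsto_sum_nat⟩

theorem ae_exists_tendsto_sum_of_tsum_eLpNorm_rpow_ne_top {q : ℝ≥0} (hq1 : 1 ≤ q) (hq2 : q ≤ 2)
    (hind : iIndepFun W P) (hmeas : ∀ k, Measurable (W k))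
    (hsum : ∑' k, eLpNorm (W k) q P ^ (q : ℝ) ≠ ∞) :
    ∀ᵐ ω ∂P, ∃ s, Tendsto (fun n => ∑ k ∈ Finset.range n, (W k ω - P[W k])) atTop (𝓝 s) := by
  have : IsProbabilityMeasure P := hind.isProbabilityMeasure
  set U : ℕ → Ω → ℝ := fun k => largePart 1 ∘ W k
  have hmeasU : ∀ k, Measurable (U k) := fun k => (measurable_largePart 1).comp (hmeas k)
  have hvar : ∑' k, eVar[W k - U k; P] ≠ ∞ :=
    ne_top_of_le_ne_top hsum (ENNReal.tsum_le_tsum fun k =>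
      evariance_sub_largePart_one_comp_le (hmeas k) (zero_lt_one.trans_le hq1).ne' hq2)
  have hsumU : ∑' k, eLpNorm (U k) 1 P ≠ ∞ :=
    ne_top_of_le_ne_top hsum (ENNReal.tsum_le_tsum fun k => eLpNorm_one_largePart_one_comp_le hq1)
  have hint : ∀ k, P[W k] = P[W k - U k] + P[U k] := by
    intro k
    have hUint : Integrable (U k) P := memLp_one_iff_integrable.mp
      ⟨(hmeasU k).aestronglyMeasurable, (ENNReal.ne_top_of_tsum_ne_top hsumU k).lt_top⟩
    rw [← integral_add' (integrable_sub_largePart_comp (hmeas k) zero_le_one) hUint,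
      sub_add_cancel]
  have hindT : iIndepFun (fun k => W k - U k) P :=
    hind.comp _ fun _ => measurable_id.sub (measurable_largePart 1)
  have hT := ae_exists_tendsto_sum_of_tsum_evariance_ne_top hindT
    (fun k => (hmeas k).sub (hmeasU k)) hvar
  have hU := ae_exists_tendsto_sum_of_tsum_eLpNorm_one_ne_top
    (fun k => (hmeasU k).aestronglyMeasurable) hsumU
  filter_upwards [hT, hU] with ω ⟨t, ht⟩ ⟨u, hu⟩
  refine ⟨t + u, (ht.add hu).congr fun n => ?_⟩
  rw [← Finset.sum_add_distrib]
  refine Finset.sum_congr rfl fun k _ => ?_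
  rw [hint, Pi.sub_apply]
  ring

end MomentSeries

section WeightedAverage

variable {m y : ℕ → ℝ}

theorem totalMass_succ (m : ℕ → ℝ) (n : ℕ) : totalMass m (n + 1) = totalMass m n + m n :=
  Finset.sum_range_succ m n

theorem monotone_totalMass (hm : ∀ k, 0 ≤ m k) : Monotone (totalMass m) :=
  monotone_nat_of_le_succ fun n => by
    rw [totalMass_succ]
    exact le_add_of_nonneg_right (hm n)

theorem totalMass_nonneg (hm : ∀ k, 0 ≤ m k) (n : ℕ) : 0 ≤ totalMass m n :=
  Finset.sum_nonneg fun k _ => hm k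

theorem le_totalMass_succ (hm : ∀ k, 0 ≤ m k) (k : ℕ) : m k ≤ totalMass m (k + 1) := by
  rw [totalMass_succ]
  exact le_add_of_nonneg_left (totalMass_nonneg hm k)

theorem abs_sum_div_totalMass_mul_le {c : ℝ} (hm : ∀ k, 0 ≤ m k) (hy : ∀ k, |y k| ≤ c) (n : ℕ) :
    |∑ k ∈ Finset.range n, m k / totalMass m n * y k| ≤ c := by
  have hc : 0 ≤ c := (abs_nonneg _).trans (hy 0)
  calc |∑ k ∈ Finset.range n, m k / totalMass m n * y k|
      ≤ ∑ k ∈ Finset.range n, m k / totalMass m n * c := by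
        refine (Finset.abs_sum_le_sum_abs _ _).trans (Finset.sum_le_sum fun k _ => ?_)
        have hweight := div_nonneg (hm k) (totalMass_nonneg hm n)
        rw [abs_mul, abs_of_nonneg hweight]
        exact mul_le_mul_of_nonneg_left (hy k) hweight
    _ = totalMass m n / totalMass m n * c := by
        rw [← Finset.sum_mul, ← Finset.sum_div, totalMass]
    _ ≤ c := mul_le_of_le_one_left hc (div_self_le_one _)

theorem tendsto_sum_div_totalMass_mul_of_tendsto_sum {s : ℝ} (hm : ∀ k, 0 ≤ m k)
    (hdiv : Tendsto (totalMass m) atTop atTop)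
    (hs : Tendsto (fun n => ∑ k ∈ Finset.range n, m k / totalMass m (k + 1) * y k) atTop (𝓝 s)) :
    Tendsto (fun n => ∑ k ∈ Finset.range n, m k / totalMass m n * y k) atTop (𝓝 0) := by
  have hcancel : ∀ k, totalMass m (k + 1) * (m k / totalMass m (k + 1)) = m k := fun k =>
    mul_div_cancel_of_imp' fun h => (hm k).antisymm' (h ▸ le_totalMass_succ hm k)
  rw [← tendsto_add_atTop_iff_nat 1]
  refine (tendsto_inv_smul_sum_smul_of_tendsto_sum
    ((monotone_totalMass hm).comp (monotone_id.add_const 1))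
    (hdiv.comp (tendsto_add_atTop_nat 1)) hs).congr fun n => ?_
  rw [smul_eq_mul, Finset.mul_sum]
  refine Finset.sum_congr rfl fun k _ => ?_
  rw [Function.comp_apply, Function.comp_apply, smul_eq_mul, ← mul_assoc (totalMass m _), id_eq,
    id_eq, hcancel, ← mul_assoc, inv_mul_eq_div]

theorem summable_div_totalMass_rpow_mul_rpow_neg {q s : ℝ} (hm : ∀ k, 0 ≤ m k)
    (hdiv : Tendsto (totalMass m) atTop atTop) (hs : 0 < s) (hsq : s ≤ q - 1) :
    Summable fun k => (m k / totalMass m (k + 1)) ^ q * m k ^ (-s) := by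
  obtain ⟨N, hN⟩ := (hdiv.eventually_gt_atTop 0).exists
  refine (summable_sub_mul_rpow hs (monotone_totalMass hm) hN).of_nonneg_of_le (fun k => ?_)
    fun k => ?_
  · have := totalMass_nonneg hm (k + 1)
    have := hm k
    positivity
  · rw [totalMass_succ m k, add_sub_cancel_left, ← totalMass_succ]
    rcases (hm k).eq_or_lt with hzero | hpos
    · rw [← hzero, zero_div, zero_mul, Real.zero_rpow (by linarith), zero_mul]
    · exact div_rpow_mul_rpow_neg_le hpos (le_totalMass_succ hm k) hsq

end WeightedAverage

section StrongLaw

variable {Ω : Type*} [MeasurableSpace Ω] {P : Measure Ω}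

theorem tsum_eLpNorm_div_totalMass_mul_rpow_ne_top {L : ℕ → Ω → ℝ} {m : ℕ → ℝ} {q : ℝ≥0} {s : ℝ}
    {D : ℝ≥0∞} (hm : ∀ k, 0 ≤ m k) (hdiv : Tendsto (totalMass m) atTop atTop) (hs : 0 < s)
    (hsq : s ≤ q - 1) (hD : D ≠ ∞)
    (hL : ∀ k, 0 < m k → eLpNorm (L k) q P ^ (q : ℝ) ≤ D * .ofReal (m k ^ (-s))) :
    ∑' k, eLpNorm (fun ω => m k / totalMass m (k + 1) * L k ω) q P ^ (q : ℝ) ≠ ∞ := by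
  have hsum := (summable_div_totalMass_rpow_mul_rpow_neg hm hdiv hs hsq).tsum_ofReal_ne_top
  refine ne_top_of_le_ne_top (ENNReal.mul_ne_top hD hsum) ?_
  rw [← ENNReal.tsum_mul_left]
  refine ENNReal.tsum_le_tsum fun k => ?_
  have hq : 0 < (q : ℝ) := by linarith
  have hweight := div_nonneg (hm k) (totalMass_nonneg hm (k + 1))
  have hscale : eLpNorm (fun ω => m k / totalMass m (k + 1) * L k ω) q P ^ (q : ℝ) =
      .ofReal ((m k / totalMass m (k + 1)) ^ (q : ℝ)) * eLpNorm (L k) q P ^ (q : ℝ) := by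
    rw [← ENNReal.ofReal_rpow_of_nonneg hweight hq.le, ← ENNReal.mul_rpow_of_nonneg _ _ hq.le,
      ← Real.enorm_of_nonneg hweight, ← eLpNorm_const_smul]
    rfl
  rw [hscale]
  rcases (hm k).eq_or_lt with hzero | hpos
  · simp [← hzero, hq.ne']
  · rw [ENNReal.ofReal_mul (by positivity), mul_left_comm]
    gcongr
    exact hL k hpos

theorem ae_tendsto_sum_div_totalMass_mul_sub_integral {L : ℕ → Ω → ℝ} {m : ℕ → ℝ} {q : ℝ≥0}
    {s : ℝ} {D : ℝ≥0∞} (hind : iIndepFun L P) (hmeas : ∀ k, Measurable (L k))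
    (hm : ∀ k, 0 ≤ m k) (hdiv : Tendsto (totalMass m) atTop atTop) (hq2 : q ≤ 2) (hs : 0 < s)
    (hsq : s ≤ q - 1) (hD : D ≠ ∞)
    (hL : ∀ k, 0 < m k → eLpNorm (L k) q P ^ (q : ℝ) ≤ D * .ofReal (m k ^ (-s))) :
    ∀ᵐ ω ∂P, Tendsto (fun n => ∑ k ∈ Finset.range n, m k / totalMass m n * (L k ω - P[L k]))
      atTop (𝓝 0) := by
  have hq1 : 1 ≤ q := by
    have : (1 : ℝ) ≤ q := by linarith
    exact_mod_cast this
  have hseries := ae_exists_tendsto_sum_of_tsum_eLpNorm_rpow_ne_top hq1 hq2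
    (hind.comp (fun k x => m k / totalMass m (k + 1) * x) fun k => measurable_const_mul _)
    (fun k => (hmeas k).const_mul _)
    (tsum_eLpNorm_div_totalMass_mul_rpow_ne_top hm hdiv hs hsq hD hL)
  filter_upwards [hseries] with ω ⟨r, hr⟩
  refine tendsto_sum_div_totalMass_mul_of_tendsto_sum (s := r) hm hdiv (hr.congr fun n => ?_)
  simp only [Function.comp_apply, integral_const_mul, mul_sub]

theorem eLpNorm_largePart_comp_rpow_le [IsProbabilityMeasure P] {f : Ω → ℝ} {p q B : ℝ≥0}
    {ε C δ s t : ℝ} (hf : Measurable f) (hq : 0 < q) (hqp : q ≤ p) (hB : eLpNorm f p P ≤ B)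
    (ht : 0 < t) (hdecay : P.real {ω | ε < |f ω|} ≤ C / t ^ δ) (hs : 0 ≤ s)
    (hsδ : s ≤ (1 - q / p : ℝ) * δ) :
    eLpNorm (largePart ε ∘ f) q P ^ (q : ℝ) ≤
      B ^ (q : ℝ) * ENNReal.ofReal (max 1 C) * ENNReal.ofReal (t ^ (-s)) := by
  have hq' : 0 < (q : ℝ) := hq
  have hp' : 0 < (p : ℝ) := hq.trans_le hqp
  have hqp' : (q : ℝ) / p ≤ 1 := (div_le_one hp').mpr hqp
  have hprob : P {ω | ε < |f ω|} ^ (1 - q / p : ℝ) ≤ .ofReal (max 1 C * t ^ (-s)) := by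
    rw [← ofReal_measureReal, ENNReal.ofReal_rpow_of_nonneg measureReal_nonneg (by linarith)]
    exact ENNReal.ofReal_le_ofReal (rpow_le_max_one_mul_rpow_neg measureReal_nonneg
      measureReal_le_one ht hdecay (by linarith) (by linarith [div_pos hq' hp']) hs hsδ)
  calc eLpNorm (largePart ε ∘ f) q P ^ (q : ℝ)
      ≤ (B * P {ω | ε < |f ω|} ^ (1 / q - 1 / p : ℝ)) ^ (q : ℝ) := by
        gcongr
        exact (eLpNorm_largePart_comp_le hf hqp ε).trans (by gcongr)
    _ = B ^ (q : ℝ) * P {ω | ε < |f ω|} ^ (1 - q / p : ℝ) := by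
        rw [ENNReal.mul_rpow_of_nonneg _ _ hq'.le, ← ENNReal.rpow_mul]
        congr 2
        field_simp
    _ ≤ B ^ (q : ℝ) * ENNReal.ofReal (max 1 C) * ENNReal.ofReal (t ^ (-s)) := by
        rw [mul_assoc, ← ENNReal.ofReal_mul (by positivity)]
        gcongr

theorem abs_integral_largePart_comp_le [IsProbabilityMeasure P] {f : Ω → ℝ} {ε : ℝ}
    (hf : Measurable f) (hint : Integrable f P) (hcentred : P[f] = 0) (hε : 0 ≤ ε) :
    |P[largePart ε ∘ f]| ≤ ε := by
  have hlarge : P[largePart ε ∘ f] = -P[f - largePart ε ∘ f] := by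
    rw [← zero_sub, ← hcentred, ← integral_sub' hint (integrable_sub_largePart_comp hf hε),
      sub_sub_cancel]
  rw [hlarge, abs_neg]
  simpa using norm_integral_le_of_norm_le_const (μ := P) (f := f - largePart ε ∘ f)
    (ae_of_all _ fun ω => abs_sub_largePart_le hε (f ω))

theorem ae_tendsto_zero_of_forall_pos_ae_eventually_norm_le {ι E : Type*}
    [SeminormedAddCommGroup E] {l : Filter ι} {f : ι → Ω → E}
    (hf : ∀ ε : ℝ, 0 < ε → ∀ᵐ ω ∂P, ∀ᶠ i in l, ‖f i ω‖ ≤ ε) :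
    ∀ᵐ ω ∂P, Tendsto (fun i => f i ω) l (𝓝 0) := by
  have hall : ∀ᵐ ω ∂P, ∀ j : ℕ, ∀ᶠ i in l, ‖f i ω‖ ≤ 1 / (j + 1 : ℝ) :=
    ae_all_iff.mpr fun j => hf _ Nat.one_div_pos_of_nat
  filter_upwards [hall] with ω hω
  rw [Metric.tendsto_nhds]
  intro ε hε
  obtain ⟨j, hj⟩ := exists_nat_one_div_lt hε
  filter_upwards [hω j] with i hi
  simpa using hi.trans_lt hj

theorem ae_tendsto_sum_div_totalMass_mul_largePart_sub_integral {Y : ℕ → Ω → ℝ} {m : ℕ → ℝ}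
    {p B : ℝ≥0} {ε δ C : ℝ} (hind : iIndepFun Y P) (hmeas : ∀ k, Measurable (Y k)) (hp : 1 < p)
    (hB : ∀ k, eLpNorm (Y k) p P ≤ B) (hδ : 0 < δ)
    (hdecay : ∀ k, 0 < m k → P.real {ω | ε < |Y k ω|} ≤ C / m k ^ δ)
    (hm : ∀ k, 0 ≤ m k) (hdiv : Tendsto (totalMass m) atTop atTop) :
    ∀ᵐ ω ∂P, Tendsto (fun n => ∑ k ∈ Finset.range n,
      m k / totalMass m n * (largePart ε (Y k ω) - P[largePart ε ∘ Y k])) atTop (𝓝 0) := by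
  have : IsProbabilityMeasure P := hind.isProbabilityMeasure
  obtain ⟨q, hq1, hq⟩ := exists_between (lt_min hp one_lt_two)
  obtain ⟨hqp, hq2⟩ := lt_min_iff.mp hq
  have hθ : 0 < 1 - (q / p : ℝ) := sub_pos.mpr ((div_lt_one (zero_lt_one.trans hp)).mpr hqp)
  have hs : 0 < min ((1 - q / p : ℝ) * δ) (q - 1) :=
    lt_min (by positivity) (sub_pos.mpr (NNReal.one_lt_coe.mpr hq1))
  exact ae_tendsto_sum_div_totalMass_mul_sub_integral
    (hind.comp _ fun _ => measurable_largePart ε)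
    (fun k => (measurable_largePart ε).comp (hmeas k)) hm hdiv hq2.le hs (min_le_right _ _)
    (by finiteness) fun k hk => eLpNorm_largePart_comp_rpow_le (hmeas k) (by positivity) hqp.le
      (hB k) hk (hdecay k hk) hs.le (min_le_left _ _)

theorem ae_tendsto_sum_div_totalMass_mul {Y : ℕ → Ω → ℝ} {m : ℕ → ℝ} {p B : ℝ≥0}
    (hind : iIndepFun Y P) (hmeas : ∀ k, Measurable (Y k)) (hcentred : ∀ k, P[Y k] = 0)
    (hp : 1 < p) (hB : ∀ k, eLpNorm (Y k) p P ≤ B)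
    (hdecay : ∀ ε : ℝ, 0 < ε → ∃ δ : ℝ, 0 < δ ∧ ∃ C : ℝ, ∀ k, 0 < m k →
      P.real {ω | ε < |Y k ω|} ≤ C / m k ^ δ)
    (hm : ∀ k, 0 ≤ m k) (hdiv : Tendsto (totalMass m) atTop atTop) :
    ∀ᵐ ω ∂P, Tendsto (fun n => ∑ k ∈ Finset.range n, m k / totalMass m n * Y k ω)
      atTop (𝓝 0) := by
  have : IsProbabilityMeasure P := hind.isProbabilityMeasure
  refine ae_tendsto_zero_of_forall_pos_ae_eventually_norm_le fun ε hε => ?_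
  have hη : 0 < ε / 3 := by positivity
  obtain ⟨δ, hδ, C, hC⟩ := hdecay (ε / 3) hη
  set c : ℕ → Ω → ℝ := fun k ω => largePart (ε / 3) (Y k ω) - P[largePart (ε / 3) ∘ Y k]
  have hcentredLarge : ∀ᵐ ω ∂P,
      Tendsto (fun n => ∑ k ∈ Finset.range n, m k / totalMass m n * c k ω) atTop (𝓝 0) :=
    ae_tendsto_sum_div_totalMass_mul_largePart_sub_integral hind hmeas hp hB hδ hC hm hdiv
  have hint : ∀ k, Integrable (Y k) P := fun k =>
    MemLp.integrable (by exact_mod_cast hp.le)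
      ⟨(hmeas k).aestronglyMeasurable, (hB k).trans_lt ENNReal.coe_lt_top⟩
  have hrest : ∀ ω k, |Y k ω - c k ω| ≤ ε / 3 + ε / 3 := fun ω k => by
    rw [← sub_add]
    exact (abs_add_le _ _).trans (add_le_add (abs_sub_largePart_le hη.le _)
      (abs_integral_largePart_comp_le (hmeas k) (hint k) (hcentred k) hη.le))
  filter_upwards [hcentredLarge] with ω hω
  filter_upwards [hω.norm.eventually_le_const (by simpa using hη : ‖(0 : ℝ)‖ < ε / 3)] with n hn
  calc ‖∑ k ∈ Finset.range n, m k / totalMass m n * Y k ω‖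
      ≤ ‖∑ k ∈ Finset.range n, m k / totalMass m n * c k ω‖ +
          ‖∑ k ∈ Finset.range n, m k / totalMass m n * (Y k ω - c k ω)‖ := by
        refine le_of_eq_of_le ?_ (norm_add_le _ _)
        simp only [← Finset.sum_add_distrib, ← mul_add, add_sub_cancel]
    _ ≤ ε / 3 + (ε / 3 + ε / 3) :=
        add_le_add hn (abs_sum_div_totalMass_mul_le hm (hrest ω) n)
    _ = ε := by ring

end StrongLaw

section Domination

theorem eLpNorm_le_of_forall_measure_lt_norm_le {α β E F : Type*} [MeasurableSpace α]
    [MeasurableSpace β] {μ : Measure α} {ν : Measure β} [NormedAddCommGroup E]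
    [NormedAddCommGroup F] {f : α → E} {g : β → F} {p : ℝ≥0} (hp : p ≠ 0)
    (hf : AEStronglyMeasurable f μ) (hg : AEStronglyMeasurable g ν)
    (htail : ∀ x : ℝ, 0 < x → μ {a | x < ‖f a‖} ≤ ν {b | x < ‖g b‖}) :
    eLpNorm f p μ ≤ eLpNorm g p ν := by
  have hp' : 0 < (p : ℝ) := by positivity
  rw [← ENNReal.rpow_le_rpow_iff hp', eLpNorm_nnreal_pow_eq_lintegral hp,
    eLpNorm_nnreal_pow_eq_lintegral hp]
  simp only [← ofReal_norm, ENNReal.ofReal_rpow_of_nonneg (norm_nonneg _) hp'.le]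
  rw [lintegral_rpow_eq_lintegral_meas_lt_mul μ (ae_of_all _ fun _ => norm_nonneg _)
      hf.norm.aemeasurable hp',
    lintegral_rpow_eq_lintegral_meas_lt_mul ν (ae_of_all _ fun _ => norm_nonneg _)
      hg.norm.aemeasurable hp']
  gcongr 1
  refine setLIntegral_mono' measurableSet_Ioi fun x hx => ?_
  gcongr
  exact htail x hx

theorem IsStochasticallyDominated.exists_eLpNorm_le {Ω : Type*} [MeasurableSpace Ω]
    {P : Measure Ω} {X : ℕ → ℝ → Ω → ℝ} (hdom : IsStochasticallyDominated P X)
    (hmeas : ∀ k t, 0 < t → Measurable (X k t)) :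
    ∃ p : ℝ≥0, 1 < p ∧ ∃ B : ℝ≥0, ∀ k t, 0 < t → eLpNorm (X k t) p P ≤ B := by
  obtain ⟨Xstar, γ, hXstar, hγ, hint, htail⟩ := hdom
  lift γ to ℝ≥0 using hγ.le
  have hp : (2 + γ : ℝ≥0) ≠ 0 := by positivity
  have hLp : MemLp Xstar (2 + γ : ℝ≥0) P :=
    (integrable_norm_rpow_iff hXstar.aestronglyMeasurable (by exact_mod_cast hp)
      ENNReal.coe_ne_top).mp (by
        simpa only [ENNReal.coe_toReal, NNReal.coe_add, NNReal.coe_ofNat, Real.norm_eq_abs]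
          using hint)
  refine ⟨2 + γ, one_lt_two.trans_le le_self_add, (eLpNorm Xstar (2 + γ : ℝ≥0) P).toNNReal,
    fun k t ht => ?_⟩
  rw [ENNReal.coe_toNNReal hLp.eLpNorm_ne_top]
  exact eLpNorm_le_of_forall_measure_lt_norm_le hp (hmeas k t ht).aestronglyMeasurable
    hXstar.aestronglyMeasurable fun x _ => htail x k t ht

end Domination

theorem theorem2p2_general {Ω : Type*} [MeasurableSpace Ω] {P : Measure Ω}
    {X : ℕ → ℝ → Ω → ℝ} {p B : ℝ≥0} {m : ℕ → ℝ} (hX : IsIndependentFamily P X)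
    (hC : IsCentred P X)
    (hdecay : ∀ ε : ℝ, 0 < ε → ∃ δ : ℝ, 0 < δ ∧ ∃ C : ℝ, ∀ t : ℝ, 0 < t → ∀ k : ℕ,
      P.real {ω | ε < |X k t ω|} ≤ C / t ^ δ)
    (hp : 1 < p) (hB : ∀ k t, 0 < t → eLpNorm (X k t) p P ≤ B)
    (hm : ∀ k, 0 ≤ m k) (hdiv : Tendsto (totalMass m) atTop atTop) :
    ∀ᵐ ω ∂P, Tendsto (fun n => incrementalSum X m n ω) atTop (𝓝 0) := by
  -- Increments of mass zero have weight zero, so their parameter may be replaced by `1`.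
  set t : ℕ → ℝ := fun k => if 0 < m k then m k else 1
  have ht : ∀ k, 0 < t k := fun k => by grind
  have htm : ∀ k, 0 < m k → t k = m k := fun k hk => if_pos hk
  have hmain := ae_tendsto_sum_div_totalMass_mul (hX.indep t ht)
    (fun k => hX.measurable k _ (ht k)) (fun k => hC k _ (ht k)) hp (fun k => hB k _ (ht k))
    (fun ε hε => by
      obtain ⟨δ, hδ, C, hC⟩ := hdecay ε hε
      exact ⟨δ, hδ, C, fun k hk => htm k hk ▸ hC (t k) (ht k) k⟩) hm hdiv
  filter_upwards [hmain] with ω hω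
  refine hω.congr fun n => Finset.sum_congr rfl fun k _ => ?_
  rcases (hm k).eq_or_lt with hzero | hpos
  · simp [← hzero]
  · rw [htm k hpos]

theorem theorem2p2 {Ω : Type*} [MeasurableSpace Ω] (P : Measure Ω) [IsProbabilityMeasure P]
    (X : ℕ → ℝ → Ω → ℝ) (hX : IsIndependentFamily P X)
    (hC : IsCentred P X) (hS1 : HasPolynomialDecay P X) (hS2 : IsStochasticallyDominated P X)
    (m : ℕ → ℝ) (hm : ∀ k, 0 ≤ m k) (hdiv : Tendsto (totalMass m) atTop atTop) :
    ∀ᵐ ω ∂P, Tendsto (fun n => incrementalSum X m n ω) atTop (𝓝 0) := by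
  obtain ⟨p, hp, B, hB⟩ := hS2.exists_eLpNorm_le hX.measurable
  obtain ⟨δ, hδ, hdecay⟩ := hS1
  exact theorem2p2_general hX hC (fun ε hε => ⟨δ, hδ, hdecay ε hε⟩) hp hB hm hdiv
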